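/- For $n \ge 1$ let $\mathrm{Maj}_n : \{0,1\}^n \to \{0,1\}$ be the majority function, $\mathrm{Maj}_n(x) = 1$ if and only if $x_1 + \cdots + x_n \ge n/2$. A function $g : \{0,1\}^n \to \{0,1\}$ is $k$-local if there is a set $I \subseteq \{1,\dots,n\}$ with $|I| = k$ such that $g$ depends only on the variables $x_i$ with $i \in I$. For $1 \le k \le n$, the $k$-composition complexity $\mathsf{CC}_k(f)$ of a function $f$ on $\{0,1\}^n$ is the minimum $m$ such that $f(x) = h(g_1(x), \dots, g_m(x))$ for all $x$, for some $k$-local functions $g_1, \dots, g_m : \{0,1\}^n \to \{0,1\}$ and an arbitrary function $h$ on $\{0,1\}^m$; the $k$-composition overhead of $f$ is $\mathsf{CC}_k(f)/(n/k)$. Write $\log$ for the logarithm to base $2$. 1. There is an absolute constant $c > 0$ such that for all integers $1 \le k \le n$ and $m \ge 0$: if $\mathrm{Maj}_n = h(g_1, \dots, g_m)$ with every $g_j : \{0,1\}^n \to \{0,1\}$ $k$-local and $h : \{0,1\}^m \to \{0,1\}$ arbitrary, then $$m \ \ge\ c \cdot \frac{n}{k} \cdot \min\left(\log k,\ \log \frac{n}{k}\right).$$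 2. For every $\varepsilon > 0$ there is a constant $c_\varepsilon > 0$ such that for all integers $n, k \ge 1$ with $k \le n^{1-\varepsilon}$, $$\mathsf{CC}_k(\mathrm{Maj}_n) \ \ge\ c_\varepsilon \cdot \frac{n}{k} \log k.$$ 3. Majority has $k$-composition overhead $\Theta(\log k)$: there is an absolute constant $C > 0$ such that $\frac{\mathsf{CC}_k(\mathrm{Maj}_n)}{n/k} \le C \log k$ for all integers $2 \le k \le n$, and for every $\varepsilon > 0$ there is a constant $c_\varepsilon > 0$ such that $\frac{\mathsf{CC}_k(\mathrm{Maj}_n)}{n/k} \ge c_\varepsilon \log k$ for all integers $n, k \ge 1$ with $k \le n^{1-\varepsilon}$. -/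

import Mathlib

/-- The point `x` of the hypercube with its `i`-th coordinate flipped. -/
def flipAt {n : ℕ} (x : Fin n → Bool) (i : Fin n) : Fin n → Bool :=
  Function.update x i (!(x i))

/-- `g` is `k`-local: it depends only on the variables of some set `I` of exactly `k` variables. -/
def IsLocal {n : ℕ} (k : ℕ) (g : (Fin n → Bool) → Bool) : Prop :=
  ∃ I : Finset (Fin n), I.card = k ∧ ∀ x : Fin n → Bool, ∀ i, i ∉ I → g x = g (flipAt x i)

/-- `f = h(g_1, …, g_m)`, where every inner function `g_j` is `k`-local. -/
def IsLocalComposition {n m : ℕ} {D : Type*} (k : ℕ) (f : (Fin n → Bool) → D)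
    (g : Fin m → (Fin n → Bool) → Bool) (h : (Fin m → Bool) → D) : Prop :=
  (∀ x, f x = h (fun j => g j x)) ∧ ∀ j, IsLocal k (g j)

/-- The `k`-composition complexity of `f`: the minimum number `m` of `k`-local inner functions
in a representation `f = h(g_1, …, g_m)`. Such a representation exists whenever `1 ≤ k ≤ n`,
see `compositionComplexity_isLeast`. -/
noncomputable def compositionComplexity {n : ℕ} {D : Type*} (k : ℕ) (f : (Fin n → Bool) → D) : ℕ :=
  sInf {m : ℕ | ∃ (g : Fin m → (Fin n → Bool) → Bool) (h : (Fin m → Bool) → D),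
    IsLocalComposition k f g h}

/-- The `k`-composition overhead of `f`: the ratio between its `k`-composition complexity
and the ideal `n / k`. -/
noncomputable def compositionOverhead {n : ℕ} {D : Type*} (k : ℕ) (f : (Fin n → Bool) → D) : ℝ :=
  (compositionComplexity k f : ℝ) / ((n : ℝ) / (k : ℝ))

/-- The Hamming weight `|x| = x_1 + ⋯ + x_n`. -/
def hammingWeight {n : ℕ} (x : Fin n → Bool) : ℕ := ∑ i, (x i).toNat

/-- The majority function: `Maj_n(x) = 1` if and only if `|x| ≥ n / 2`. -/
def majority (n : ℕ) (x : Fin n → Bool) : Bool :=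
  decide ((n : ℚ) / 2 ≤ (hammingWeight x : ℚ))

/-- For `1 ≤ k ≤ n` the minimum in the definition of composition complexity is attained. -/
theorem compositionComplexity_isLeast {n : ℕ} {D : Type*} (k : ℕ) (hk : 1 ≤ k) (hkn : k ≤ n)
    (f : (Fin n → Bool) → D) :
    IsLeast {m : ℕ | ∃ (g : Fin m → (Fin n → Bool) → Bool) (h : (Fin m → Bool) → D),
      IsLocalComposition k f g h} (compositionComplexity k f) := by
  refine ⟨Nat.sInf_mem ⟨n, fun j x => x j, f, fun x => rfl, fun j => ?_⟩,
    fun m hm => Nat.sInf_le hm⟩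
  obtain ⟨I, hI, hcard⟩ := Finset.exists_superset_card_eq (s := ({j} : Finset (Fin n))) (n := k)
    (by simpa using hk) (by simpa using hkn)
  refine ⟨I, hcard, fun x i hi => ?_⟩
  have hij : j ≠ i := by
    rintro rfl
    exact hi (hI (by simp))
  simp [flipAt, Function.update_of_ne hij]

/-! Lower bound. Let D exceed twice the average number mk/n of inner functions reading a variable,
and keep the variables read by at most D of them. Unless n < 4Dk (and then log (n/k) = O(D)), a
random two-colouring of the inner functions yields two sets of kept variables, each of size at least
n/2^O(D), that no inner function reads simultaneously (`exists_split`). Varying the number of ones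
on one set moves the majority threshold across the other set A, so the inner functions determine the
Hamming weight on A (`card_le_of_separated`).

Maps z of such low degree cannot determine weight cheaply (`card_le_of_weight_determined`).
Correlate the parity of a set of outputs with ζ^|x| for a root of unity ζ. As z determines |x|,
Parseval gives the squared correlations the same total Q for every ζ. Output sets that avoid the at
most D outputs influenced by a given coordinate still carry, on average over ζ, at least a 2^(-D)
share of Q. Hence for some ζ ≠ 1 much mass lies on output sets insensitive to many coordinates; but
each such coordinate contributes a factor |1+ζ|/2 < 1 to the correlation, so this is possible only
with many outputs. Thus |A| ≤ 2^O(D)·m, and together with mk ≤ nD this forces log k = O(D).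

Upper bound: cut the input into blocks of k variables and output the binary digits of each block
weight. -/

/-- The number of `true` coordinates of a point of a hypercube indexed by a finite type. -/
def boolWeight {ι : Type*} [Fintype ι] (x : ι → Bool) : ℕ := ∑ i, (x i).toNat

/-- The sign `(-1) ^ b`. -/
def boolSign (b : Bool) : ℝ := if b then -1 else 1

lemma boolSign_mul_self (b : Bool) : boolSign b * boolSign b = 1 := by
  cases b <;> simp [boolSign]

lemma one_add_boolSign_mul_nonneg (a b : Bool) : 0 ≤ 1 + boolSign a * boolSign b := by
  cases a <;> cases b <;> simp [boolSign]

lemma one_add_boolSign_mul_of_ne {a b : Bool} (h : a ≠ b) :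
    1 + boolSign a * boolSign b = 0 := by
  cases a <;> cases b <;> simp_all [boolSign]

lemma abs_boolSign (b : Bool) : |boolSign b| = 1 := by
  cases b <;> simp [boolSign]

/-! ### Fourier coefficients twisted by ζ^|x| -/

section Twisted

variable {ι κ : Type*} [Fintype ι] [DecidableEq ι]

/-- Averaging over a single coordinate on which the remaining factor does not depend. -/
lemma sum_mul_coord (G : (ι → Bool) → ℂ) (a : Bool → ℂ) (i : ι)
    (hG : ∀ x b, G (Function.update x i b) = G x) :
    ∑ x, G x * a (x i) = ((a false + a true) / 2) * ∑ x, G x := by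
  let e : (ι → Bool) ≃ (ι → Bool) :=
    { toFun := fun x => Function.update x i (!(x i))
      invFun := fun x => Function.update x i (!(x i))
      left_inv := fun x => by simp
      right_inv := fun x => by simp }
  have h1 : ∑ x, G x * a (x i) = ∑ x, G x * a (!(x i)) := by
    rw [← Equiv.sum_comp e]
    refine Finset.sum_congr rfl fun x _ => ?_
    simp [e, hG]
  have h2 : ∑ x, G x * a (x i) + ∑ x, G x * a (!(x i)) = (a false + a true) * ∑ x, G x := by
    rw [← Finset.sum_add_distrib, Finset.mul_sum]
    refine Finset.sum_congr rfl fun x _ => ?_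
    cases x i <;> simp <;> ring
  rw [← h1] at h2
  linear_combination h2 / 2

lemma sum_mul_prod_coord (φ : (ι → Bool) → ℂ) (a : Bool → ℂ) (U : Finset ι)
    (hφ : ∀ i ∈ U, ∀ x b, φ (Function.update x i b) = φ x) :
    ∑ x, φ x * ∏ i ∈ U, a (x i) = ((a false + a true) / 2) ^ U.card * ∑ x, φ x := by
  induction U using Finset.induction_on with
  | empty => simp
  | insert i U hi ih =>
    have h := sum_mul_coord (fun x => φ x * ∏ j ∈ U, a (x j)) a i (fun x b => by
      rw [hφ i (Finset.mem_insert_self i U)]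
      congr 1
      refine Finset.prod_congr rfl fun j hj => ?_
      rw [Function.update_of_ne]
      rintro rfl
      exact hi hj)
    rw [ih fun j hj => hφ j (Finset.mem_insert_of_mem hj)] at h
    rw [Finset.card_insert_of_notMem hi, pow_succ']
    rw [mul_assoc, ← h]
    refine Finset.sum_congr rfl fun x _ => ?_
    rw [Finset.prod_insert hi]
    ring

/-- The correlation of the parity of the functions `z · j`, `j ∈ S`, with `ζ ^ |x|`. -/
noncomputable def twistedSum (z : (ι → Bool) → κ → Bool) (ζ : ℂ) (S : Finset κ) : ℂ :=
  ∑ x, ((∏ j ∈ S, boolSign (z x j) : ℝ) : ℂ) * ζ ^ boolWeight x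

lemma abs_prod_boolSign (y : κ → Bool) (S : Finset κ) : |∏ j ∈ S, boolSign (y j)| = 1 := by
  rw [Finset.abs_prod]
  exact Finset.prod_eq_one fun j _ => abs_boolSign _

/-- Parseval: expand the squares and sum over S first. The product on the right is 2^|T| if z x and
z y agree on T, and 0 otherwise. -/
lemma sum_powerset_normSq_twistedSum (z : (ι → Bool) → κ → Bool) (ζ : ℂ) (T : Finset κ) :
    ∑ S ∈ T.powerset, Complex.normSq (twistedSum z ζ S) =
      ∑ x, ∑ y, (∏ j ∈ T, (1 + boolSign (z x j) * boolSign (z y j))) *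
        (ζ ^ boolWeight x * (starRingEnd ℂ ζ) ^ boolWeight y).re := by
  have h : ∀ S, Complex.normSq (twistedSum z ζ S) =
      ∑ x, ∑ y, (∏ j ∈ S, (boolSign (z x j) * boolSign (z y j))) *
        (ζ ^ boolWeight x * (starRingEnd ℂ ζ) ^ boolWeight y).re := by
    intro S
    have h1 : ((Complex.normSq (twistedSum z ζ S) : ℝ) : ℂ) =
        ∑ x, ∑ y, ((∏ j ∈ S, (boolSign (z x j) * boolSign (z y j)) : ℝ) : ℂ) *
          (ζ ^ boolWeight x * (starRingEnd ℂ ζ) ^ boolWeight y) := by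
      rw [← Complex.mul_conj, twistedSum, map_sum, Finset.sum_mul_sum]
      refine Finset.sum_congr rfl fun x _ => Finset.sum_congr rfl fun y _ => ?_
      rw [map_mul, Complex.conj_ofReal, map_pow, Finset.prod_mul_distrib]
      push_cast
      ring
    have h2 := congrArg Complex.re h1
    rw [Complex.ofReal_re] at h2
    rw [h2]
    simp only [Complex.re_sum, Complex.re_ofReal_mul]
  simp only [h]
  rw [Finset.sum_comm]
  refine Finset.sum_congr rfl fun x _ => ?_
  rw [Finset.sum_comm]
  refine Finset.sum_congr rfl fun y _ => ?_
  rw [← Finset.sum_mul, Finset.prod_one_add]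

/-- The parity ignores the coordinates in U, so these average out independently, each contributing a
factor (1+ζ)/2. -/
lemma normSq_twistedSum_le (z : (ι → Bool) → κ → Bool) {ζ : ℂ} (hζ : ‖ζ‖ = 1) (S : Finset κ)
    (U : Finset ι) (hU : ∀ i ∈ U, ∀ j ∈ S, ∀ x b, z (Function.update x i b) j = z x j) :
    Complex.normSq (twistedSum z ζ S) ≤
      4 ^ Fintype.card ι * (‖1 + ζ‖ ^ 2 / 4) ^ U.card := by
  have h1 : twistedSum z ζ S =
      ∑ x : ι → Bool, (((∏ j ∈ S, boolSign (z x j) : ℝ) : ℂ) * ∏ i ∈ Uᶜ, ζ ^ (x i).toNat) *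
        ∏ i ∈ U, (fun b : Bool => ζ ^ b.toNat) (x i) := by
    refine Finset.sum_congr rfl fun x _ => ?_
    rw [mul_assoc, Finset.prod_compl_mul_prod, boolWeight, Finset.prod_pow_eq_pow_sum]
  rw [sum_mul_prod_coord
    (fun x => ((∏ j ∈ S, boolSign (z x j) : ℝ) : ℂ) * ∏ i ∈ Uᶜ, ζ ^ (x i).toNat)
    (fun b : Bool => ζ ^ b.toNat) U (fun i hi x b => ?_)] at h1
  · have h2 : ‖twistedSum z ζ S‖ ≤ (‖1 + ζ‖ / 2) ^ U.card * 2 ^ Fintype.card ι := by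
      rw [h1, norm_mul, norm_pow, norm_div]
      simp only [Bool.toNat_false, pow_zero, Bool.toNat_true, pow_one, Complex.norm_ofNat]
      gcongr
      refine (norm_sum_le _ _).trans ?_
      rw [Finset.sum_congr rfl (g := fun _ => (1 : ℝ))]
      · simp
      · intro x _
        rw [norm_mul, Complex.norm_real, Real.norm_eq_abs, abs_prod_boolSign, norm_prod]
        simp [hζ]
    rw [Complex.normSq_eq_norm_sq]
    calc ‖twistedSum z ζ S‖ ^ 2 ≤ ((‖1 + ζ‖ / 2) ^ U.card * 2 ^ Fintype.card ι) ^ 2 := by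
          gcongr
      _ = _ := by
          rw [mul_pow, ← pow_mul, ← pow_mul, mul_comm _ 2, mul_comm _ 2, pow_mul, pow_mul, div_pow]
          norm_num [mul_comm]
  · congr 1
    · congr 1
      exact Finset.prod_congr rfl fun j hj => by rw [hU i hi j hj]
    · refine Finset.prod_congr rfl fun j hj => ?_
      rw [Function.update_of_ne]
      rintro rfl
      exact (Finset.mem_compl.1 hj) hi

end Twisted

/-! ### Roots of unity -/

/-- The standard primitive root of unity of order `M`. -/
noncomputable def unitRoot (M : ℕ) : ℂ := Complex.exp (2 * Real.pi / M * Complex.I)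

lemma unitRoot_pow_eq (M l : ℕ) :
    unitRoot M ^ l = Complex.exp ((2 * Real.pi * l / M : ℝ) * Complex.I) := by
  rw [unitRoot, ← Complex.exp_nat_mul]
  congr 1
  push_cast
  ring

lemma norm_unitRoot_pow (M l : ℕ) : ‖unitRoot M ^ l‖ = 1 := by
  rw [unitRoot_pow_eq, Complex.norm_exp_ofReal_mul_I]

lemma unitRoot_pow_self {M : ℕ} (hM : 0 < M) : unitRoot M ^ M = 1 := by
  rw [unitRoot_pow_eq]
  have : (M : ℝ) ≠ 0 := by positivity
  rw [mul_div_assoc, div_self this, mul_one]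
  push_cast
  exact Complex.exp_two_pi_mul_I

lemma sum_pow_eq_of_pow_eq_one {η : ℂ} {M : ℕ} (h : η ^ M = 1) :
    ∑ l ∈ Finset.range M, η ^ l = if η = 1 then (M : ℂ) else 0 := by
  split_ifs with h1
  · simp [h1]
  · have := geom_sum_mul η M
    rw [h, sub_self] at this
    exact (mul_eq_zero.1 this).resolve_right (sub_ne_zero.2 h1)

/-- Orthogonality of characters: the sum is always 0 or M. -/
lemma re_sum_unitRoot_pow {M : ℕ} (hM : 0 < M) (a b : ℕ) :
    0 ≤ ∑ l ∈ Finset.range M,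
        ((unitRoot M ^ l) ^ a * (starRingEnd ℂ (unitRoot M ^ l)) ^ b).re ∧
      (a = b → ∑ l ∈ Finset.range M,
        ((unitRoot M ^ l) ^ a * (starRingEnd ℂ (unitRoot M ^ l)) ^ b).re = M) := by
  have h1 : (unitRoot M ^ a * (starRingEnd ℂ (unitRoot M)) ^ b) ^ M = 1 := by
    rw [mul_pow, ← pow_mul, ← pow_mul, mul_comm a, mul_comm b, pow_mul, pow_mul, ← map_pow,
      unitRoot_pow_self hM]
    simp
  have h2 : ∑ l ∈ Finset.range M,
      ((unitRoot M ^ l) ^ a * (starRingEnd ℂ (unitRoot M ^ l)) ^ b).re =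
      (if unitRoot M ^ a * (starRingEnd ℂ (unitRoot M)) ^ b = 1 then (M : ℂ) else 0).re := by
    rw [← sum_pow_eq_of_pow_eq_one h1, Complex.re_sum]
    refine Finset.sum_congr rfl fun l _ => ?_
    rw [map_pow, mul_pow, ← pow_mul, ← pow_mul, ← pow_mul, ← pow_mul, mul_comm a, mul_comm b]
  rw [h2]
  refine ⟨by split_ifs <;> simp, ?_⟩
  rintro rfl
  have h3 : unitRoot M * starRingEnd ℂ (unitRoot M) = 1 := by
    have := norm_unitRoot_pow M 1
    rw [pow_one] at this
    rw [Complex.mul_conj, Complex.normSq_eq_norm_sq, this]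
    simp
  rw [if_pos (by rw [← mul_pow, h3, one_pow])]
  simp

/-- The left side is cos² t with t = πl/M, and Jordan's inequality sin t ≥ 2t/π, applied to t or π -
t, gives sin t ≥ 2/M. -/
lemma norm_one_add_unitRoot_pow_sq_le {M l : ℕ} (h0 : 0 < l) (hl : l < M) :
    ‖1 + unitRoot M ^ l‖ ^ 2 / 4 ≤ Real.exp (-(4 / (M : ℝ) ^ 2)) := by
  have hM : (0 : ℝ) < M := by exact_mod_cast h0.trans hl
  set t : ℝ := Real.pi * l / M with ht
  have h1 : ‖1 + unitRoot M ^ l‖ ^ 2 / 4 = 1 - Real.sin t ^ 2 := by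
    have : (2 * Real.pi * l / M : ℝ) = 2 * t := by rw [ht]; ring
    rw [unitRoot_pow_eq, this, ← Complex.normSq_eq_norm_sq, Complex.normSq_apply]
    simp only [Complex.add_re, Complex.one_re, Complex.exp_ofReal_mul_I_re, Complex.add_im,
      Complex.one_im, Complex.exp_ofReal_mul_I_im]
    rw [Real.cos_two_mul, Real.sin_two_mul]
    nlinarith [Real.sin_sq_add_cos_sq t]
  have hl1 : (1 : ℝ) ≤ l := by exact_mod_cast h0
  have hlM : (l : ℝ) + 1 ≤ M := by exact_mod_cast hl
  have hpi := Real.pi_pos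
  have h2 : 2 / (M : ℝ) ≤ Real.sin t := by
    rcases le_total t (Real.pi / 2) with h | h
    · refine le_trans ?_ (Real.mul_le_sin (by positivity) h)
      rw [ht]
      have : 2 / Real.pi * (Real.pi * l / M) = 2 * l / M := by field_simp
      rw [this]
      gcongr
      linarith
    · rw [← Real.sin_pi_sub]
      have ht' : Real.pi - t = Real.pi * (M - l) / M := by rw [ht]; field_simp
      refine le_trans ?_ (Real.mul_le_sin ?_ (by linarith))
      · rw [ht']
        have : 2 / Real.pi * (Real.pi * (M - l) / M) = 2 * (M - l) / M := by field_simp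
        rw [this]
        gcongr
        linarith
      · rw [ht']
        apply div_nonneg _ hM.le
        apply mul_nonneg hpi.le
        linarith
  have h3 : 4 / (M : ℝ) ^ 2 ≤ Real.sin t ^ 2 := by
    calc 4 / (M : ℝ) ^ 2 = (2 / (M : ℝ)) ^ 2 := by rw [div_pow]; norm_num
      _ ≤ _ := by gcongr
  rw [h1]
  have := Real.add_one_le_exp (-(4 / (M : ℝ) ^ 2))
  linarith

lemma prod_one_add_boolSign_self {κ : Type*} (y : κ → Bool) (T : Finset κ) :
    ∏ j ∈ T, (1 + boolSign (y j) * boolSign (y j)) = 2 ^ T.card := by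
  rw [Finset.prod_congr rfl (g := fun _ => (2 : ℝ))
    (fun j _ => by rw [boolSign_mul_self]; norm_num)]
  simp

/-! ### Low-degree maps that determine the weight -/

section WeightBound

variable {ι κ : Type*} [Fintype ι] [DecidableEq ι] [Fintype κ]

/-- The number of pairs of points that `z` does not separate. -/
def collisions (z : (ι → Bool) → κ → Bool) : ℝ := ∑ x, ∑ y, if z x = z y then 1 else 0

/-- By Parseval and orthogonality every pair (x, y) contributes a nonnegative amount, and a
colliding pair contributes exactly 2^|T|·M. -/
lemma le_sum_powerset_normSq_twistedSum (z : (ι → Bool) → κ → Bool)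
    (hz : ∀ x y, z x = z y → boolWeight x = boolWeight y) {M : ℕ} (hM : 0 < M) (T : Finset κ) :
    2 ^ T.card * M * collisions z ≤ ∑ l ∈ Finset.range M, ∑ S ∈ T.powerset,
      Complex.normSq (twistedSum z (unitRoot M ^ l) S) := by
  simp only [sum_powerset_normSq_twistedSum]
  rw [Finset.sum_comm, collisions, Finset.mul_sum]
  refine Finset.sum_le_sum fun x _ => ?_
  rw [Finset.sum_comm, Finset.mul_sum]
  refine Finset.sum_le_sum fun y _ => ?_
  rw [← Finset.mul_sum]
  obtain ⟨h1, h2⟩ := re_sum_unitRoot_pow hM (boolWeight x) (boolWeight y)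
  split_ifs with h
  · rw [h2 (hz x y h), h, prod_one_add_boolSign_self, mul_one]
  · rw [mul_zero]
    exact mul_nonneg (Finset.prod_nonneg fun j _ => one_add_boolSign_mul_nonneg _ _) h1

/-- Only colliding pairs survive in the full Parseval sum; they have equal weight, so ζ cancels. -/
lemma sum_normSq_twistedSum (z : (ι → Bool) → κ → Bool)
    (hz : ∀ x y, z x = z y → boolWeight x = boolWeight y) {ζ : ℂ} (hζ : ‖ζ‖ = 1) :
    ∑ S : Finset κ, Complex.normSq (twistedSum z ζ S) =
      2 ^ Fintype.card κ * collisions z := by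
  rw [← Finset.powerset_univ, sum_powerset_normSq_twistedSum, collisions, Finset.mul_sum]
  refine Finset.sum_congr rfl fun x _ => ?_
  rw [Finset.mul_sum]
  refine Finset.sum_congr rfl fun y _ => ?_
  split_ifs with h
  · have h3 : ζ * starRingEnd ℂ ζ = 1 := by
      rw [Complex.mul_conj, Complex.normSq_eq_norm_sq, hζ]
      simp
    rw [hz x y h, ← mul_pow, h3, h, prod_one_add_boolSign_self]
    simp
  · obtain ⟨j, hj⟩ := Function.ne_iff.1 h
    rw [Finset.prod_eq_zero (Finset.mem_univ j) (one_add_boolSign_mul_of_ne hj)]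
    simp

/-- Keep only the term S = ∅, ζ = 1 of Parseval. -/
lemma four_pow_le_collisions (z : (ι → Bool) → κ → Bool)
    (hz : ∀ x y, z x = z y → boolWeight x = boolWeight y) :
    (4 : ℝ) ^ Fintype.card ι ≤ 2 ^ Fintype.card κ * collisions z := by
  rw [← sum_normSq_twistedSum z hz (ζ := 1) (by simp)]
  refine le_trans (le_of_eq ?_) (Finset.single_le_sum
    (f := fun S => Complex.normSq (twistedSum z 1 S)) (fun S _ => Complex.normSq_nonneg _)
    (Finset.mem_univ ∅))
  simp [twistedSum, Complex.normSq_eq_norm_sq, ← pow_mul, mul_comm _ 2]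
  simp [pow_mul]
  norm_num

/-- Double counting of the mass `sq l S`, weighted by the number of coordinates i with `J i`
disjoint from S. -/
lemma one_le_two_pow_mul_exp [DecidableEq κ] (z : (ι → Bool) → κ → Bool) (J : ι → Finset κ) (D : ℕ)
    (hJ : ∀ i, (J i).card ≤ D)
    (hloc : ∀ i j, j ∉ J i → ∀ x b, z (Function.update x i b) j = z x j)
    (hz : ∀ x y, z x = z y → boolWeight x = boolWeight y) (hι : 0 < Fintype.card ι) :
    (1 : ℝ) ≤ 2 ^ (D + 1) * 2 ^ Fintype.card κ *
      Real.exp (-(Fintype.card ι / (16 * 8 ^ D))) := by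
  set n := Fintype.card ι with hn
  set m := Fintype.card κ with hm
  set E := Real.exp (-((n : ℝ) / (16 * 8 ^ D))) with hE
  -- Chosen so that M·2^(-D) = 4: the lower bound 4nQ beats the nQ from l = 0 plus the nQ from sets
  -- with few missed coordinates.
  set M : ℕ := 4 * 2 ^ D with hMdef
  have hM : 0 < M := by positivity
  set P := collisions z
  set Q := (2 : ℝ) ^ m * P with hQ
  set sq : ℕ → Finset κ → ℝ := fun l S => Complex.normSq (twistedSum z (unitRoot M ^ l) S)
    with hsq
  have hsq0 : ∀ l S, 0 ≤ sq l S := fun l S => Complex.normSq_nonneg _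
  set c : Finset κ → Finset ι := fun S => Finset.univ.filter fun i => Disjoint (J i) S with hc
  have hQ4 : (4 : ℝ) ^ n ≤ Q := four_pow_le_collisions z hz
  have hQ0 : 0 < Q := lt_of_lt_of_le (by positivity) hQ4
  have hn0 : (0 : ℝ) < n := by exact_mod_cast hι
  have hcn : ∀ S, ((c S).card : ℝ) ≤ n := fun S => by exact_mod_cast Finset.card_le_univ _
  have hsumQ : ∀ l, ∑ S, sq l S = Q := fun l =>
    sum_normSq_twistedSum z hz (norm_unitRoot_pow M l)
  have hMr : (M : ℝ) = 4 * 2 ^ D := by rw [hMdef]; push_cast; ring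
  -- Cutoff between few and many missed coordinates; τM = 1 makes the former cost nQ over all l.
  set τ : ℝ := 1 / (4 * 2 ^ D) with hτ
  have hτM : τ * M = 1 := by rw [hτ, hMr]; field_simp
  have hlower : n * (4 * Q) ≤ ∑ l ∈ Finset.range M, ∑ S, ((c S).card : ℝ) * sq l S := by
    have h1 : ∑ l ∈ Finset.range M, ∑ S, ((c S).card : ℝ) * sq l S =
        ∑ i, ∑ l ∈ Finset.range M, ∑ S ∈ (J i)ᶜ.powerset, sq l S := by
      rw [Finset.sum_comm (s := (Finset.univ : Finset ι))]
      refine Finset.sum_congr rfl fun l _ => ?_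
      have h2 : ∀ i, ∑ S ∈ (J i)ᶜ.powerset, sq l S =
          ∑ S : Finset κ, if Disjoint (J i) S then sq l S else 0 := by
        intro i
        rw [← Finset.sum_filter]
        refine Finset.sum_congr ?_ fun _ _ => rfl
        ext S
        simp [Finset.subset_compl_iff_disjoint_left]
      simp only [h2]
      rw [Finset.sum_comm]
      refine Finset.sum_congr rfl fun S _ => ?_
      rw [← Finset.sum_filter, Finset.sum_const, nsmul_eq_mul]
    rw [h1]
    have h3 : ∀ i ∈ (Finset.univ : Finset ι),
        4 * Q ≤ ∑ l ∈ Finset.range M, ∑ S ∈ (J i)ᶜ.powerset, sq l S := by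
      intro i _
      refine le_trans ?_ (le_sum_powerset_normSq_twistedSum z hz hM (J i)ᶜ)
      have hP : 0 ≤ P := by
        by_contra h
        have : Q ≤ 0 := mul_nonpos_of_nonneg_of_nonpos (by positivity) (by linarith)
        linarith
      have h4 : (2 : ℝ) ^ m ≤ 2 ^ (J i)ᶜ.card * 2 ^ D := by
        rw [← pow_add]
        refine pow_le_pow_right₀ (by norm_num) ?_
        have := Finset.card_add_card_compl (J i)
        have := hJ i
        omega
      rw [hMr, hQ]
      calc 4 * (2 ^ m * P) ≤ 4 * ((2 ^ (J i)ᶜ.card * 2 ^ D) * P) := by gcongr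
        _ = _ := by ring
    refine le_trans (le_of_eq ?_) (Finset.card_nsmul_le_sum _ _ _ h3)
    rw [Finset.card_univ, nsmul_eq_mul]
  have hupper : ∀ l ∈ Finset.range M, ∑ S, ((c S).card : ℝ) * sq l S ≤
      (if l = 0 then n * Q else 0) + (τ * n * Q + n * 2 ^ m * Q * E) := by
    intro l hl
    split_ifs with h0
    · have : ∑ S, ((c S).card : ℝ) * sq l S ≤ n * Q := by
        rw [← hsumQ l, Finset.mul_sum]
        exact Finset.sum_le_sum fun S _ => mul_le_mul_of_nonneg_right (hcn S) (hsq0 _ _)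
      have h5 : 0 ≤ τ * n * Q + n * 2 ^ m * Q * E := by positivity
      linarith
    · rw [zero_add]
      have key : ∀ S ∈ (Finset.univ : Finset (Finset κ)),
          ((c S).card : ℝ) * sq l S ≤ τ * n * sq l S + n * Q * E := by
        intro S _
        rcases le_total ((c S).card : ℝ) (τ * n) with h | h
        · have := mul_le_mul_of_nonneg_right h (hsq0 l S)
          have h6 : 0 ≤ n * Q * E := by positivity
          linarith
        · have h7 : sq l S ≤ Q * E := by
            have h8 := normSq_twistedSum_le z (norm_unitRoot_pow M l) S (c S) (by
              intro i hi j hj x b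
              refine hloc i j ?_ x b
              exact fun hji => Finset.disjoint_left.1 (Finset.mem_filter.1 hi).2 hji hj)
            have h9 : (‖1 + unitRoot M ^ l‖ ^ 2 / 4) ^ (c S).card ≤ E := by
              refine (pow_le_pow_left₀ (by positivity) (norm_one_add_unitRoot_pow_sq_le
                (Nat.pos_of_ne_zero h0) (Finset.mem_range.1 hl)) _).trans ?_
              rw [← Real.exp_nat_mul, hE]
              refine Real.exp_le_exp.2 ?_
              have : (n : ℝ) / (16 * 8 ^ D) = τ * n * (4 / (M : ℝ) ^ 2) := by
                rw [hMr, hτ, show (8 : ℝ) = 2 ^ 3 by norm_num, ← pow_mul]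
                field_simp
                ring
              rw [this, mul_neg, neg_le_neg_iff]
              gcongr
            calc sq l S ≤ _ := h8
              _ ≤ Q * E := by gcongr
          calc ((c S).card : ℝ) * sq l S ≤ n * (Q * E) :=
                mul_le_mul (hcn S) h7 (hsq0 _ _) hn0.le
            _ ≤ τ * n * sq l S + n * Q * E := by
                have : 0 ≤ τ * n * sq l S := mul_nonneg (by positivity) (hsq0 _ _)
                linarith
      refine (Finset.sum_le_sum key).trans (le_of_eq ?_)
      rw [Finset.sum_add_distrib, ← Finset.mul_sum, hsumQ]
      simp [hm]
      ring
  have h10 := hlower.trans (Finset.sum_le_sum hupper)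
  rw [Finset.sum_add_distrib, Finset.sum_ite_eq' , if_pos (Finset.mem_range.2 hM),
    Finset.sum_const, Finset.card_range, nsmul_eq_mul] at h10
  have h11 : n * Q * 4 ≤ n * Q * (2 + M * 2 ^ m * E) := by
    calc n * Q * 4 = n * (4 * Q) := by ring
      _ ≤ _ := h10
      _ = n * Q * (1 + τ * M + M * 2 ^ m * E) := by ring
      _ = _ := by rw [hτM]; ring
  have h12 := le_of_mul_le_mul_left h11 (by positivity)
  rw [hMr] at h12
  rw [pow_succ]
  linarith

/-- If the Hamming weight of `x` can be recovered from `z x` and each coordinate of `x` affects at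
most `D` coordinates of `z x`, then `z x` has many coordinates. -/
theorem card_le_of_weight_determined [DecidableEq κ] (z : (ι → Bool) → κ → Bool) (J : ι → Finset κ) (D : ℕ)
    (hJ : ∀ i, (J i).card ≤ D)
    (hloc : ∀ i j, j ∉ J i → ∀ x b, z (Function.update x i b) j = z x j)
    (hz : ∀ x y, z x = z y → boolWeight x = boolWeight y) :
    Fintype.card ι ≤ 16 * 8 ^ D * (Fintype.card κ + D + 1) := by
  rcases Nat.eq_zero_or_pos (Fintype.card ι) with h | h
  · rw [h]; exact Nat.zero_le _
  have h1 := one_le_two_pow_mul_exp z J D hJ hloc hz h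
  rw [← pow_add, Real.exp_neg, ← div_eq_mul_inv, one_le_div (Real.exp_pos _)] at h1
  have h2 : (2 : ℝ) ≤ Real.exp 1 := by
    have := Real.add_one_le_exp (1 : ℝ)
    linarith
  have h3 : Real.exp ((Fintype.card ι : ℝ) / (16 * 8 ^ D)) ≤
      Real.exp ((D + 1 + Fintype.card κ : ℕ) : ℝ) := by
    refine h1.trans ?_
    rw [← mul_one ((D + 1 + Fintype.card κ : ℕ) : ℝ), Real.exp_nat_mul]
    gcongr
  have h4 := Real.exp_le_exp.1 h3
  rw [div_le_iff₀ (by positivity)] at h4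
  have h5 : ((Fintype.card ι : ℕ) : ℝ) ≤
      ((16 * 8 ^ D * (Fintype.card κ + D + 1) : ℕ) : ℝ) := by
    push_cast at h4 ⊢
    linarith
  exact_mod_cast h5

end WeightBound

/-! ### From majority to weight -/

lemma IsLocal.exists_support {n k : ℕ} {g : (Fin n → Bool) → Bool} (h : IsLocal k g) :
    ∃ I : Finset (Fin n), I.card = k ∧ ∀ x y : Fin n → Bool, (∀ i ∈ I, x i = y i) → g x = g y := by
  obtain ⟨I, hI, hloc⟩ := h
  refine ⟨I, hI, fun x y hxy => ?_⟩
  have hupd : ∀ x : Fin n → Bool, ∀ i ∉ I, ∀ b, g (Function.update x i b) = g x := by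
    intro x i hi b
    rcases eq_or_ne b (x i) with rfl | hb
    · rw [Function.update_eq_self]
    · rw [hloc x i hi, flipAt]
      congr 2
      cases b <;> cases hx : x i <;> simp_all
  have key : ∀ T : Finset (Fin n), Disjoint T I → g (T.piecewise y x) = g x := by
    intro T
    induction T using Finset.induction_on with
    | empty => intro _; simp
    | insert i T _ ih =>
      intro hT
      rw [Finset.disjoint_insert_left] at hT
      rw [Finset.piecewise_insert, hupd _ i hT.1, ih hT.2]
  rw [← key Iᶜ disjoint_compl_left]
  congr 1
  funext i
  by_cases hi : i ∈ I
  · simp [hi, hxy]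
  · simp [hi]

lemma majority_eq_true_iff {n : ℕ} (x : Fin n → Bool) :
    majority n x = true ↔ n ≤ 2 * hammingWeight x := by
  rw [majority, decide_eq_true_iff, div_le_iff₀ (by norm_num), mul_comm]
  exact_mod_cast Iff.rfl

lemma boolWeight_le_card {ι : Type*} [Fintype ι] (x : ι → Bool) :
    boolWeight x ≤ Fintype.card ι := by
  refine (Finset.sum_le_card_nsmul _ _ 1 fun i _ => Bool.toNat_le _).trans ?_
  simp

/-- The point that agrees with `x` on `S` and with the indicator of `W` elsewhere. -/
def glue {n : ℕ} (S W : Finset (Fin n)) (x : {i // i ∈ S} → Bool) (i : Fin n) : Bool :=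
  if h : i ∈ S then x ⟨i, h⟩ else decide (i ∈ W)

lemma hammingWeight_glue {n : ℕ} {S W : Finset (Fin n)} (h : Disjoint S W)
    (x : {i // i ∈ S} → Bool) : hammingWeight (glue S W x) = boolWeight x + W.card := by
  rw [hammingWeight, ← Finset.sum_add_sum_compl S]
  congr 1
  · rw [← Finset.sum_coe_sort S]
    exact Finset.sum_congr rfl fun i _ => by simp [glue]
  · have h1 : ∀ i ∈ Sᶜ, (glue S W x i).toNat = if i ∈ W then 1 else 0 := by
      intro i hi
      rw [glue, dif_neg (Finset.mem_compl.1 hi)]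
      by_cases hW : i ∈ W <;> simp [hW]
    rw [Finset.sum_congr rfl h1, Finset.sum_ite_mem, Finset.sum_const, smul_eq_mul, mul_one]
    congr 1
    exact Finset.inter_eq_right.2 (Finset.subset_compl_iff_disjoint_left.2 h)

/-- Every variable of majority is relevant. -/
lemma exists_mem_support {n m : ℕ} {g : Fin m → (Fin n → Bool) → Bool}
    {h : (Fin m → Bool) → Bool} {I : Fin m → Finset (Fin n)}
    (hf : ∀ x, majority n x = h fun j => g j x)
    (hg : ∀ j x y, (∀ i ∈ I j, x i = y i) → g j x = g j y) (i : Fin n) : ∃ j, i ∈ I j := by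
  by_contra! hi
  -- With ⌈n/2⌉ - 1 other ones, coordinate i is pivotal.
  obtain ⟨W, hW, hWc⟩ := Finset.exists_subset_card_eq (s := ({i} : Finset (Fin n))ᶜ)
    (n := (n + 1) / 2 - 1) (by
      rw [Finset.card_compl, Fintype.card_fin, Finset.card_singleton]; omega)
  have hdisj : Disjoint {i} W := Finset.subset_compl_iff_disjoint_left.1 hW
  have heq : majority n (glue {i} W fun _ => true) = majority n (glue {i} W fun _ => false) := by
    rw [hf, hf]
    congr 1
    funext j
    refine hg j _ _ fun i' hi' => ?_
    have : i' ∉ ({i} : Finset (Fin n)) := by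
      rw [Finset.mem_singleton]
      rintro rfl
      exact hi j hi'
    simp [glue, this]
  have hn : 0 < n := i.pos
  have h1 : majority n (glue {i} W fun _ => true) = true := by
    rw [majority_eq_true_iff, hammingWeight_glue hdisj, hWc]
    simp [boolWeight]
    omega
  rw [heq, majority_eq_true_iff, hammingWeight_glue hdisj, hWc] at h1
  simp [boolWeight] at h1
  omega

/-- If no inner function touches both of the disjoint sets `S` and `C` of the same size, then the
inner functions touching `S` determine the Hamming weight on `S`. -/
lemma card_le_of_separated {n m : ℕ} {g : Fin m → (Fin n → Bool) → Bool}
    {h : (Fin m → Bool) → Bool} {I : Fin m → Finset (Fin n)}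
    (hf : ∀ x, majority n x = h fun j => g j x)
    (hg : ∀ j x y, (∀ i ∈ I j, x i = y i) → g j x = g j y)
    {S C : Finset (Fin n)} (hSC : Disjoint S C) (hcard : S.card = C.card)
    (hsep : ∀ j, Disjoint (I j) S ∨ Disjoint (I j) C) {D : ℕ}
    (hD : ∀ i ∈ S, (Finset.univ.filter fun j => i ∈ I j).card ≤ D) :
    S.card ≤ 16 * 8 ^ D * (m + D + 1) := by
  have hsum : 2 * S.card ≤ n := by
    have := Finset.card_le_univ (S ∪ C)
    rw [Finset.card_union_of_disjoint hSC, Fintype.card_fin] at this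
    omega
  obtain ⟨W, hW, hWc⟩ := Finset.exists_subset_card_eq (s := (S ∪ C)ᶜ)
    (n := (n + 1) / 2 - S.card) (by
      rw [Finset.card_compl, Fintype.card_fin, Finset.card_union_of_disjoint hSC]; omega)
  have hWdisj : Disjoint (S ∪ C) W := Finset.subset_compl_iff_disjoint_left.1 hW
  rw [Finset.disjoint_union_left] at hWdisj
  let z : ({i // i ∈ S} → Bool) → Fin m → Bool := fun x j => g j (glue S W x)
  have hlt : ∀ x y, z x = z y → ¬ boolWeight x < boolWeight y := by
    intro x y hxy hlt
    have hy : boolWeight y ≤ S.card := by simpa using boolWeight_le_card y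
    -- Together with W these ones bring the total for y to exactly ⌈n/2⌉, leaving x below it.
    obtain ⟨Y, hY, hYc⟩ := Finset.exists_subset_card_eq (s := C)
      (n := S.card - boolWeight y) (by omega)
    have hYW : (W ∪ Y).card = (n + 1) / 2 - S.card + (S.card - boolWeight y) := by
      rw [Finset.card_union_of_disjoint (hWdisj.2.symm.mono_right hY), hWc, hYc]
    have hSWY : Disjoint S (W ∪ Y) :=
      Finset.disjoint_union_right.2 ⟨hWdisj.1, hSC.mono_right hY⟩
    have heq : majority n (glue S (W ∪ Y) x) = majority n (glue S (W ∪ Y) y) := by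
      rw [hf, hf]
      congr 1
      funext j
      -- An inner function missing S cannot tell x from y; one missing C cannot see Y, so its value
      -- is a coordinate of z.
      rcases hsep j with hj | hj
      · refine hg j _ _ fun i hi => ?_
        simp [glue, Finset.disjoint_left.1 hj hi]
      · have h1 : ∀ x, g j (glue S (W ∪ Y) x) = g j (glue S W x) := by
          refine fun x => hg j _ _ fun i hi => ?_
          have : i ∉ Y := fun hiY => Finset.disjoint_left.1 hj hi (hY hiY)
          simp [glue, this]
        rw [h1, h1]
        exact congrFun hxy j
    have h1 : majority n (glue S (W ∪ Y) y) = true := by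
      rw [majority_eq_true_iff, hammingWeight_glue hSWY, hYW]
      omega
    rw [← heq, majority_eq_true_iff, hammingWeight_glue hSWY, hYW] at h1
    omega
  have := card_le_of_weight_determined z
    (fun i => Finset.univ.filter fun j => (i : Fin n) ∈ I j) D (fun i => hD i i.2)
    (fun i j hj x b => by
      refine hg j _ _ fun i' hi' => ?_
      rw [glue, glue]
      split_ifs with hS
      · rw [Function.update_of_ne]
        rintro rfl
        simp [hi'] at hj
      · rfl)
    (fun x y hxy => le_antisymm (not_lt.1 (hlt y x hxy.symm)) (not_lt.1 (hlt x y hxy)))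
  simpa using this

/-- A random subset `F` of the blocks splits a positive fraction of `L` to either side. -/
lemma exists_split {n m : ℕ} (I : Fin m → Finset (Fin n)) {k D : ℕ} (hI : ∀ j, (I j).card ≤ k)
    (L : Finset (Fin n)) (hL : ∀ i ∈ L, (Finset.univ.filter fun j => i ∈ I j).card ≤ D)
    (hDk : 2 * (D * k) ≤ L.card) :
    ∃ F : Finset (Fin m),
      L.card ≤ 2 * 4 ^ D * (L.filter fun i => ∀ j, i ∈ I j → j ∈ F).card ∧
      L.card ≤ 2 * 4 ^ D * (L.filter fun i => ∀ j, i ∈ I j → j ∉ F).card := by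
  set J : Fin n → Finset (Fin m) := fun i => Finset.univ.filter fun j => i ∈ I j with hJ
  set S : Finset (Fin m) → Finset (Fin n) := fun F => L.filter fun i => ∀ j, i ∈ I j → j ∈ F
    with hS
  set C : Finset (Fin m) → Finset (Fin n) := fun F => L.filter fun i => ∀ j, i ∈ I j → j ∉ F
    with hC
  have hgood : ∀ i ∈ L, L.card ≤ 2 * (L.filter fun i' => Disjoint (J i) (J i')).card := by
    intro i hi
    have h1 : (L.filter fun i' => ¬ Disjoint (J i) (J i')).card ≤ D * k := by
      have h2 : (L.filter fun i' => ¬ Disjoint (J i) (J i')) ⊆ (J i).biUnion I := by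
        intro i' hi'
        obtain ⟨j, hj, hj'⟩ := Finset.not_disjoint_iff.1 (Finset.mem_filter.1 hi').2
        exact Finset.mem_biUnion.2 ⟨j, hj, (Finset.mem_filter.1 hj').2⟩
      refine (Finset.card_le_card h2).trans ((Finset.card_biUnion_le_card_mul _ _ k
        fun j _ => hI j).trans (Nat.mul_le_mul_right _ (hL i hi)))
    have h3 := Finset.card_filter_add_card_filter_not (s := L)
      (fun i' => Disjoint (J i) (J i'))
    omega
  have hcount : ∀ i ∈ L, ∀ i' ∈ L, Disjoint (J i) (J i') →
      2 ^ m ≤ 4 ^ D * (Finset.univ.filter fun F => i ∈ S F ∧ i' ∈ C F).card := by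
    intro i hi i' hi' hd
    -- The condition is J i ⊆ F ⊆ (J i')ᶜ, which leaves at least m - 2D free choices.
    have h1 : (Finset.univ.filter fun F => i ∈ S F ∧ i' ∈ C F) = Finset.Icc (J i) (J i')ᶜ := by
      ext F
      simp only [hS, hC, hJ, Finset.mem_filter, Finset.mem_univ, true_and, Finset.mem_Icc, hi, hi',
        Finset.subset_iff, Finset.mem_compl]
      refine and_congr Iff.rfl ⟨fun h j hj hj' => h j hj' hj, fun h j hj hj' => h hj' hj⟩
    rw [h1, Finset.card_Icc_finset (Finset.subset_compl_iff_disjoint_right.2 hd),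
      show (4 : ℕ) = 2 ^ 2 by norm_num, ← pow_mul, ← pow_add]
    refine Nat.pow_le_pow_right (by norm_num) ?_
    rw [Finset.card_compl, Fintype.card_fin]
    have h2 : (J i).card ≤ D := hL i hi
    have h3 : (J i').card ≤ D := hL i' hi'
    omega
  have hsum : ∑ F : Finset (Fin m), L.card ^ 2 ≤
      ∑ F : Finset (Fin m), 2 * 4 ^ D * ((S F).card * (C F).card) := by
    have h1 : ∀ F, (S F).card * (C F).card =
        ∑ i ∈ L, ∑ i' ∈ L, if i ∈ S F ∧ i' ∈ C F then 1 else 0 := by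
      intro F
      have h2 : S F ×ˢ C F = (L ×ˢ L).filter fun p => p.1 ∈ S F ∧ p.2 ∈ C F := by
        ext p
        simp only [Finset.mem_product, Finset.mem_filter, hS, hC]
        tauto
      rw [← Finset.card_product, h2, Finset.card_filter, Finset.sum_product]
    simp only [h1]
    rw [← Finset.mul_sum, Finset.sum_comm, Finset.sum_const, Finset.card_univ, Fintype.card_finset,
      Fintype.card_fin, smul_eq_mul]
    have h3 : ∀ i ∈ L, 2 ^ m * L.card ≤ 2 * 4 ^ D *
        ∑ F : Finset (Fin m), ∑ i' ∈ L, if i ∈ S F ∧ i' ∈ C F then 1 else 0 := by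
      intro i hi
      rw [Finset.sum_comm]
      calc 2 ^ m * L.card ≤ 2 ^ m * (2 * (L.filter fun i' => Disjoint (J i) (J i')).card) :=
            Nat.mul_le_mul_left _ (hgood i hi)
        _ = 2 * ∑ i' ∈ L.filter fun i' => Disjoint (J i) (J i'), 2 ^ m := by
            rw [Finset.sum_const, smul_eq_mul]; ring
        _ ≤ 2 * ∑ i' ∈ L.filter fun i' => Disjoint (J i) (J i'),
              4 ^ D * ∑ F : Finset (Fin m), if i ∈ S F ∧ i' ∈ C F then 1 else 0 := by
            refine Nat.mul_le_mul_left _ (Finset.sum_le_sum fun i' hi' => ?_)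
            rw [← Finset.card_filter]
            exact hcount i hi i' (Finset.mem_filter.1 hi').1 (Finset.mem_filter.1 hi').2
        _ ≤ 2 * ∑ i' ∈ L, 4 ^ D * ∑ F : Finset (Fin m), if i ∈ S F ∧ i' ∈ C F then 1 else 0 :=
            Nat.mul_le_mul_left _ (Finset.sum_le_sum_of_subset (Finset.filter_subset _ _))
        _ = _ := by rw [← Finset.mul_sum, mul_assoc]
    have h4 := Finset.card_nsmul_le_sum L _ _ h3
    rw [smul_eq_mul, ← Finset.mul_sum] at h4
    calc 2 ^ m * L.card ^ 2 = L.card * (2 ^ m * L.card) := by ring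
      _ ≤ _ := h4
  obtain ⟨F, -, hF⟩ := Finset.exists_le_of_sum_le Finset.univ_nonempty hsum
  refine ⟨F, ?_, ?_⟩
  · rcases Nat.eq_zero_or_pos L.card with h0 | h0
    · omega
    refine Nat.le_of_mul_le_mul_right ?_ h0
    calc L.card * L.card = L.card ^ 2 := by ring
      _ ≤ 2 * 4 ^ D * ((S F).card * (C F).card) := hF
      _ ≤ 2 * 4 ^ D * ((S F).card * L.card) := by
          gcongr
          exact Finset.filter_subset _ _
      _ = _ := by ring
  · rcases Nat.eq_zero_or_pos L.card with h0 | h0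
    · omega
    refine Nat.le_of_mul_le_mul_right ?_ h0
    calc L.card * L.card = L.card ^ 2 := by ring
      _ ≤ 2 * 4 ^ D * ((S F).card * (C F).card) := hF
      _ ≤ 2 * 4 ^ D * (L.card * (C F).card) := by
          gcongr
          exact Finset.filter_subset _ _
      _ = _ := by ring

/-- D bounds the degree of at least half of the variables by Markov. The factor 3 absorbs the
rounding, since n ≤ mk by relevance of every variable. -/
lemma exists_degree_of_isLocalComposition {n k m : ℕ} (hk : 1 ≤ k) (hkn : k ≤ n)
    {g : Fin m → (Fin n → Bool) → Bool} {h : (Fin m → Bool) → Bool}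
    (hcomp : IsLocalComposition k (majority n) g h) :
    ∃ D : ℕ, 1 ≤ D ∧ D * n ≤ 3 * (m * k) ∧ (n < 4 * (D * k) ∨ k ≤ 320 * 64 ^ D) := by
  obtain ⟨hf, hloc⟩ := hcomp
  choose I hI hg using fun j => (hloc j).exists_support
  have hrel := exists_mem_support hf hg
  set d : Fin n → ℕ := fun i => (Finset.univ.filter fun j => i ∈ I j).card with hd
  have hdsum : ∑ i, d i = m * k := by
    have h1 : ∀ i, d i = ∑ j, if i ∈ I j then 1 else 0 := fun i => by
      exact Finset.card_filter _ _
    simp only [h1]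
    rw [Finset.sum_comm]
    simp [hI]
  have hd1 : ∀ i, 1 ≤ d i := fun i => by
    obtain ⟨j, hj⟩ := hrel i
    exact Finset.card_pos.2 ⟨j, by simp [hj]⟩
  have hnmk : n ≤ m * k := by
    rw [← hdsum]
    simpa using Finset.card_nsmul_le_sum Finset.univ d 1 fun i _ => hd1 i
  have hn : 0 < n := by omega
  set D := 2 * (m * k) / n + 1 with hD
  have hDlow : 2 * (m * k) < n * D := Nat.lt_mul_div_succ _ hn
  have hDup : D * n ≤ 2 * (m * k) + n := by
    rw [hD, add_mul, one_mul]
    exact Nat.add_le_add_right (Nat.div_mul_le_self _ _) _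
  refine ⟨D, Nat.le_add_left _ _, by omega, ?_⟩
  by_contra! hcon
  obtain ⟨h4, hkbig⟩ := hcon
  set L : Finset (Fin n) := Finset.univ.filter fun i => d i ≤ D with hL
  have hLcard : n ≤ 2 * L.card := by
    have h1 : L.card + (Finset.univ.filter fun i => ¬ d i ≤ D).card = n := by
      rw [hL, Finset.card_filter_add_card_filter_not, Finset.card_univ, Fintype.card_fin]
    have h2 : (Finset.univ.filter fun i => ¬ d i ≤ D).card * D ≤ m * k := by
      rw [← hdsum, ← smul_eq_mul]
      refine (Finset.card_nsmul_le_sum _ d D fun i hi => ?_).trans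
        (Finset.sum_le_sum_of_subset (Finset.filter_subset _ _))
      exact (not_le.1 (Finset.mem_filter.1 hi).2).le
    have h3 : 2 * (Finset.univ.filter fun i => ¬ d i ≤ D).card < n := by
      refine Nat.lt_of_mul_lt_mul_right (a := D) ?_
      rw [mul_assoc]
      omega
    omega
  obtain ⟨F, hS, hC⟩ := exists_split I (fun j => (hI j).le) L
    (fun i hi => (Finset.mem_filter.1 hi).2) (by omega : 2 * (D * k) ≤ L.card)
  set S := L.filter fun i => ∀ j, i ∈ I j → j ∈ F with hSdef
  set C := L.filter fun i => ∀ j, i ∈ I j → j ∉ F with hCdef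
  -- Trim both sides to the same size.
  obtain ⟨S', hS', hS'c⟩ := Finset.exists_subset_card_eq (min_le_left S.card C.card)
  obtain ⟨C', hC', hC'c⟩ := Finset.exists_subset_card_eq (min_le_right S.card C.card)
  have hmin : L.card ≤ 2 * 4 ^ D * S'.card := by
    rw [hS'c]
    rcases min_choice S.card C.card with h | h <;> rw [h] <;> assumption
  have hbound := card_le_of_separated hf hg (S := S') (C := C')
    (Finset.disjoint_left.2 fun i hi hi' => by
      obtain ⟨j, hj⟩ := hrel i
      exact (Finset.mem_filter.1 (hC' hi')).2 j hj ((Finset.mem_filter.1 (hS' hi)).2 j hj))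
    (hS'c.trans hC'c.symm) (fun j => by
      by_cases hj : j ∈ F
      · exact Or.inr (Finset.disjoint_left.2 fun i hi hi' =>
          (Finset.mem_filter.1 (hC' hi')).2 j hi hj)
      · exact Or.inl (Finset.disjoint_left.2 fun i hi hi' =>
          hj ((Finset.mem_filter.1 (hS' hi')).2 j hi)))
    (D := D) (fun i hi => (Finset.mem_filter.1 (Finset.mem_filter.1 (hS' hi)).1).2)
  have hm : 1 ≤ m := by
    rcases Nat.eq_zero_or_pos m with h | h
    · rw [h] at hnmk; omega
    · exact h
  have hDm : D ≤ 2 * m + 1 := by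
    refine Nat.le_of_mul_le_mul_right (hDup.trans ?_) hn
    have : m * k ≤ m * n := Nat.mul_le_mul_left _ hkn
    calc 2 * (m * k) + n ≤ 2 * (m * n) + n := by omega
      _ = _ := by ring
  have h5 : n ≤ 320 * 32 ^ D * m := by
    calc n ≤ 2 * L.card := hLcard
      _ ≤ 2 * (2 * 4 ^ D * S'.card) := by gcongr
      _ ≤ 2 * (2 * 4 ^ D * (16 * 8 ^ D * (m + D + 1))) := by gcongr
      _ ≤ 2 * (2 * 4 ^ D * (16 * 8 ^ D * (5 * m))) := by gcongr 2 * (2 * 4 ^ D * (16 * 8 ^ D * ?_)); omega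
      _ = 320 * 32 ^ D * m := by
          rw [show (32 : ℕ) = 4 * 8 by norm_num, mul_pow]; ring
  have h6 : k * n ≤ 320 * 64 ^ D * n := by
    calc k * n ≤ k * (320 * 32 ^ D * m) := by gcongr
      _ = 320 * 32 ^ D * (m * k) := by ring
      _ ≤ 320 * 32 ^ D * (n * D) :=
          Nat.mul_le_mul_left _ (by omega)
      _ ≤ 320 * 32 ^ D * (n * 2 ^ D) := by
          gcongr
          exact Nat.lt_two_pow_self.le
      _ = 320 * 64 ^ D * n := by
          rw [show (64 : ℕ) = 32 * 2 by norm_num, mul_pow]; ring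
  exact absurd (Nat.le_of_mul_le_mul_right h6 hn) (not_le.2 hkbig)

/-- The lower bound for the number of local functions that determine majority. -/
theorem le_card_of_isLocalComposition_majority {n k m : ℕ} (hk : 1 ≤ k) (hkn : k ≤ n)
    {g : Fin m → (Fin n → Bool) → Bool} {h : (Fin m → Bool) → Bool}
    (hcomp : IsLocalComposition k (majority n) g h) :
    1 / 45 * ((n : ℝ) / k * min (Real.logb 2 k) (Real.logb 2 ((n : ℝ) / k))) ≤ m := by
  obtain ⟨D, hD1, hD, hcase⟩ := exists_degree_of_isLocalComposition hk hkn hcomp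
  have hk0 : (0 : ℝ) < k := by exact_mod_cast hk
  have hn0 : (0 : ℝ) < n := by exact_mod_cast hk.trans hkn
  have hD1' : (1 : ℝ) ≤ D := by exact_mod_cast hD1
  have hD' : (D : ℝ) * n ≤ 3 * (m * k) := by exact_mod_cast hD
  -- The constant 15 comes from 320·64^D ≤ 2^(9+6D) and D ≥ 1.
  have hmin : min (Real.logb 2 k) (Real.logb 2 ((n : ℝ) / k)) ≤ 15 * D := by
    rcases hcase with hc | hc
    · refine (min_le_right _ _).trans ?_
      have hc' : (n : ℝ) < 4 * (D * k) := by exact_mod_cast hc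
      have h1 : (n : ℝ) / k ≤ 4 * D := by
        rw [div_le_iff₀ hk0]
        linarith
      have h2 : (4 * D : ℝ) ≤ 2 ^ (4 * D) := by
        exact_mod_cast (Nat.lt_two_pow_self (n := 4 * D)).le
      have h3 : Real.logb 2 ((n : ℝ) / k) ≤ (4 * D : ℕ) := by
        rw [Real.logb_le_iff_le_rpow (by norm_num) (by positivity), Real.rpow_natCast]
        exact h1.trans h2
      push_cast at h3
      linarith
    · refine (min_le_left _ _).trans ?_
      have h3 : Real.logb 2 (k : ℝ) ≤ (9 + 6 * D : ℕ) := by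
        rw [Real.logb_le_iff_le_rpow (by norm_num) (by positivity), Real.rpow_natCast]
        have h4 : k ≤ 2 ^ (9 + 6 * D) := by
          refine hc.trans ?_
          rw [pow_add, pow_mul]
          exact Nat.mul_le_mul (by norm_num) (by norm_num)
        exact_mod_cast h4
      push_cast at h3
      linarith
  calc 1 / 45 * ((n : ℝ) / k * min (Real.logb 2 k) (Real.logb 2 ((n : ℝ) / k)))
      ≤ 1 / 45 * ((n : ℝ) / k * (15 * D)) := by gcongr
    _ = D * n / (3 * k) := by field_simp; ring
    _ ≤ m := by
        rw [div_le_iff₀ (by positivity)]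
        linarith

/-! ### Upper bound by block weights -/

/-- The weight of the `b`-th block of `k` consecutive coordinates. -/
def blockWeight {n : ℕ} (k b : ℕ) (x : Fin n → Bool) : ℕ :=
  ∑ i with i.val / k = b, (x i).toNat

lemma card_block_le {n k : ℕ} (hk : 1 ≤ k) (b : ℕ) :
    (Finset.univ.filter fun i : Fin n => i.val / k = b).card ≤ k := by
  conv_rhs => rw [← Finset.card_range k]
  refine Finset.card_le_card_of_injOn (fun i : Fin n => i.val % k)
    (fun i _ => by simpa using Nat.mod_lt _ hk) fun i hi j hj hij => ?_
  simp only [Finset.coe_filter, Finset.mem_univ, true_and, Set.mem_ofPred_eq] at hi hj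
  rw [Fin.ext_iff, ← Nat.div_add_mod i.val k, ← Nat.div_add_mod j.val k, hi, hj]
  exact congrArg _ hij

lemma blockWeight_le {n k : ℕ} (hk : 1 ≤ k) (b : ℕ) (x : Fin n → Bool) :
    blockWeight k b x ≤ k := by
  refine (Finset.sum_le_card_nsmul _ _ 1 fun i _ => Bool.toNat_le _).trans ?_
  simpa using card_block_le hk b

lemma sum_blockWeight {n : ℕ} (k : ℕ) (x : Fin n → Bool) :
    ∑ b ∈ Finset.range (n / k + 1), blockWeight k b x = hammingWeight x := by
  refine Finset.sum_fiberwise_of_maps_to (fun i _ => ?_) _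
  exact Finset.mem_range.2 (Nat.lt_succ_of_le (Nat.div_le_div_right i.isLt.le))

lemma compositionComplexity_majority_le {n k : ℕ} (hk : 1 ≤ k) (hkn : k ≤ n) :
    compositionComplexity k (majority n) ≤ (n / k + 1) * (Nat.log 2 k + 1) := by
  classical
  refine (compositionComplexity_isLeast k hk hkn (majority n)).2 ?_
  let g : Fin ((n / k + 1) * (Nat.log 2 k + 1)) → (Fin n → Bool) → Bool := fun j x =>
    (blockWeight k (finProdFinEquiv.symm j).1 x).testBit (finProdFinEquiv.symm j).2
  have hg : ∀ x y, (∀ j, g j x = g j y) → majority n x = majority n y := by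
    intro x y hxy
    have hw : hammingWeight x = hammingWeight y := by
      rw [← sum_blockWeight k, ← sum_blockWeight k]
      refine Finset.sum_congr rfl fun b hb => Nat.eq_of_testBit_eq fun t => ?_
      by_cases ht : t < Nat.log 2 k + 1
      · have h1 := hxy (finProdFinEquiv (⟨b, Finset.mem_range.1 hb⟩, ⟨t, ht⟩))
        simp only [g, Equiv.symm_apply_apply] at h1
        exact h1
      · have h1 : ∀ x : Fin n → Bool, (blockWeight k b x).testBit t = false := fun x =>
          Nat.testBit_lt_two_pow ((blockWeight_le hk b x).trans_lt
            ((Nat.lt_pow_succ_log_self (by norm_num) k).trans_le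
              (Nat.pow_le_pow_right (by norm_num) (not_lt.1 ht))))
        rw [h1, h1]
    rw [majority, majority, hw]
  refine ⟨g, fun y => decide (∃ x, (fun j => g j x) = y ∧ majority n x = true), fun x => ?_,
    fun j => ?_⟩
  · rw [Bool.eq_iff_iff, decide_eq_true_iff]
    exact ⟨fun h => ⟨x, rfl, h⟩, fun ⟨y, hy, h⟩ => hg y x (fun j => congrFun hy j) ▸ h⟩
  -- Locality asks for exactly k variables, so a short last block is padded.
  · obtain ⟨I, hI, hcard⟩ := Finset.exists_superset_card_eq
      (card_block_le hk ((finProdFinEquiv.symm j).1 : ℕ)) (by simpa using hkn)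
    refine ⟨I, hcard, fun x i hi => ?_⟩
    have : blockWeight k (finProdFinEquiv.symm j).1 x =
        blockWeight k (finProdFinEquiv.symm j).1 (flipAt x i) := by
      refine Finset.sum_congr rfl fun i' hi' => ?_
      rw [flipAt, Function.update_of_ne]
      rintro rfl
      exact hi (hI hi')
    simp only [g, this]

lemma compositionOverhead_majority_le {n k : ℕ} (hk : 2 ≤ k) (hkn : k ≤ n) :
    compositionOverhead k (majority n) ≤ 4 * Real.logb 2 k := by
  have hk0 : (0 : ℝ) < k := by positivity
  have hn0 : (0 : ℝ) < n := by exact_mod_cast (by omega : 0 < n)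
  rw [compositionOverhead, div_le_iff₀ (by positivity)]
  have h1 : (compositionComplexity k (majority n) : ℝ) ≤
      ((n / k : ℕ) + 1) * (Nat.log 2 k + 1) := by
    exact_mod_cast compositionComplexity_majority_le (by omega) hkn
  have h2 : ((n / k : ℕ) : ℝ) ≤ n / k := Nat.cast_div_le
  have h3 : (1 : ℝ) ≤ n / k := by
    rw [one_le_div hk0]
    exact_mod_cast hkn
  have h4 : (Nat.log 2 k : ℝ) ≤ Real.logb 2 k := by exact_mod_cast Real.natLog_le_logb k 2
  have h5 : (1 : ℝ) ≤ Real.logb 2 k := by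
    rw [Real.le_logb_iff_rpow_le (by norm_num) hk0, Real.rpow_one]
    exact_mod_cast hk
  calc (compositionComplexity k (majority n) : ℝ)
      ≤ ((n / k : ℕ) + 1) * (Nat.log 2 k + 1) := h1
    _ ≤ ((n : ℝ) / k + n / k) * (Real.logb 2 k + Real.logb 2 k) := by gcongr
    _ = _ := by ring

/-! ### The regime k ≤ n^(1-ε) and conclusion -/

lemma le_compositionComplexity_majority {ε : ℝ} (hε : 0 < ε) {n k : ℕ} (hn : 1 ≤ n) (hk : 1 ≤ k)
    (hkn : (k : ℝ) ≤ (n : ℝ) ^ (1 - ε)) :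
    1 / 45 * min 1 ε * ((n : ℝ) / k * Real.logb 2 k) ≤ compositionComplexity k (majority n) := by
  have hk1 : (1 : ℝ) ≤ k := by exact_mod_cast hk
  have hn1 : (1 : ℝ) ≤ n := by exact_mod_cast hn
  have hle : (k : ℝ) ≤ n := by
    refine hkn.trans ?_
    calc (n : ℝ) ^ (1 - ε) ≤ (n : ℝ) ^ (1 : ℝ) :=
          Real.rpow_le_rpow_of_exponent_le hn1 (by linarith)
      _ = n := Real.rpow_one _
  have hle' : k ≤ n := by exact_mod_cast hle
  obtain ⟨g, h, hcomp⟩ := (compositionComplexity_isLeast k hk hle' (majority n)).1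
  refine le_trans ?_ (le_card_of_isLocalComposition_majority hk hle' hcomp)
  have hlogk : 0 ≤ Real.logb 2 k := Real.logb_nonneg (by norm_num) hk1
  have hlog1 : Real.logb 2 k ≤ Real.logb 2 n :=
    Real.logb_le_logb_of_le (by norm_num) (by linarith) hle
  have hlog2 : Real.logb 2 k ≤ (1 - ε) * Real.logb 2 n := by
    rw [← Real.logb_rpow_eq_mul_logb_of_pos (by linarith)]
    exact Real.logb_le_logb_of_le (by norm_num) (by linarith) hkn
  -- Here log (n/k) ≥ ε log n ≥ ε log k.
  have hmin : min 1 ε * Real.logb 2 k ≤ min (Real.logb 2 k) (Real.logb 2 ((n : ℝ) / k)) := by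
    refine le_min ?_ ?_
    · exact mul_le_of_le_one_left hlogk (min_le_left _ _)
    · rw [Real.logb_div (by linarith) (by linarith)]
      have h1 : min 1 ε * Real.logb 2 k ≤ ε * Real.logb 2 n :=
        mul_le_mul (min_le_right _ _) hlog1 hlogk hε.le
      linarith
  calc 1 / 45 * min 1 ε * ((n : ℝ) / k * Real.logb 2 k)
      = 1 / 45 * ((n : ℝ) / k * (min 1 ε * Real.logb 2 k)) := by ring
    _ ≤ _ := by gcongr

/-- The lower bound for every representation of majority, its consequence for `k ≤ n ^ (1 - ε)`,
and the composition overhead `Θ(log k)` (upper bound for all `2 ≤ k ≤ n`, lower bound for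
`k ≤ n ^ (1 - ε)`). -/
theorem theorem1 :
    (∃ c : ℝ, 0 < c ∧ ∀ n k m : ℕ, 1 ≤ k → k ≤ n →
      ∀ (g : Fin m → (Fin n → Bool) → Bool) (h : (Fin m → Bool) → Bool),
        IsLocalComposition k (majority n) g h →
          c * ((n : ℝ) / k * min (Real.logb 2 k) (Real.logb 2 ((n : ℝ) / k))) ≤ (m : ℝ)) ∧
    (∀ ε : ℝ, 0 < ε → ∃ c : ℝ, 0 < c ∧ ∀ n k : ℕ, 1 ≤ n → 1 ≤ k →
      (k : ℝ) ≤ (n : ℝ) ^ (1 - ε) →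
        c * ((n : ℝ) / k * Real.logb 2 k) ≤ (compositionComplexity k (majority n) : ℝ)) ∧
    (∃ C : ℝ, 0 < C ∧ ∀ n k : ℕ, 2 ≤ k → k ≤ n →
      compositionOverhead k (majority n) ≤ C * Real.logb 2 k) ∧
    (∀ ε : ℝ, 0 < ε → ∃ c : ℝ, 0 < c ∧ ∀ n k : ℕ, 1 ≤ n → 1 ≤ k →
      (k : ℝ) ≤ (n : ℝ) ^ (1 - ε) →
        c * Real.logb 2 k ≤ compositionOverhead k (majority n)) := by
  refine ⟨⟨1 / 45, by norm_num, fun n k m hk hkn g h hcomp =>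
      le_card_of_isLocalComposition_majority hk hkn hcomp⟩,
    fun ε hε => ⟨1 / 45 * min 1 ε, by positivity, fun n k hn hk hkn =>
      le_compositionComplexity_majority hε hn hk hkn⟩,
    ⟨4, by norm_num, fun n k hk hkn => compositionOverhead_majority_le hk hkn⟩,
    fun ε hε => ⟨1 / 45 * min 1 ε, by positivity, fun n k hn hk hkn => ?_⟩⟩
  have hk0 : (0 : ℝ) < k := by exact_mod_cast hk
  have hn0 : (0 : ℝ) < n := by exact_mod_cast hn
  rw [compositionOverhead, le_div_iff₀ (by positivity)]
  refine le_trans (le_of_eq ?_) (le_compositionComplexity_majority hε hn hk hkn)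
  ring
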